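/- A function $\rho:[0,\infty)\to[0,\infty)$ is of class $\mathcal K_\infty$ if it is continuous, strictly increasing, unbounded and $\rho(0)=0$. A continuous function $\beta:[0,\infty)\times[0,\infty)\to[0,\infty)$ is of class $\mathcal{KL}_0$ if $\lim_{t\to\infty}\beta(r,t)=0$ for each $r>0$ and, for each $t\ge 0$, either $\beta(\cdot,t)\in\mathcal K_\infty$ or $\beta(\cdot,t)\equiv 0$. For $\beta\in\mathcal{KL}_0$, $\omega\ge 1$ and $k\in\mathbb N_{\ge 1}$ put $B_k(r):=\sum_{n=0}^{k-2}\beta(r,n)+\omega\,\beta(r,k-1)$. For $N\ge 2$ and $m\in\{1,\dots,N-1\}$ let $$\alpha_{N,m}^\omega:=\inf_{\lambda_0,\dots,\lambda_{N-1},\nu}\ \frac{\sum_{n=0}^{N-2}\lambda_n+\omega\lambda_{N-1}-\nu}{\sum_{n=0}^{m-1}\lambda_n}$$ where the infimum (in $[-\infty,\infty]$, with $\inf\emptyset=+\infty$) is over all real $\lambda_0,\dots,\lambda_{N-1},\nu>0$ satisfying $$\sum_{n=k}^{N-2}\lambda_n+\omega\lambda_{N-1}\le B_{N-k}(\lambda_k)\quad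 (k=0,\dots,N-2),\qquad \nu\le\sum_{n=0}^{j-1}\lambda_{n+m}+B_{N-j}(\lambda_{j+m})\quad (j=0,\dots,N-m-1).$$ **Proposition.** Let $\beta\in\mathcal{KL}_0$ satisfy one of the following two conditions: 1. (exponential controllability) there are $C\ge 1$ and $\sigma\in(0,1)$ with $\beta(r,n)=C\sigma^n r$ for all $r\ge 0$, $n\in\mathbb N_0$; 2. (finite-time controllability) there is a real sequence $(c_n)_{n\in\mathbb N_0}$ with $c_n\ge 0$ for all $n$, $c_n=0$ for all $n\ge 3$, and $\beta(r,n)=c_n r$ for all $r\ge 0$, $n\in\mathbb N_0$; and moreover $\beta(r,n+m)\le\beta(\beta(r,n),m)$ for all $r\ge 0$, $n,m\in\mathbb N_0$. Then for all $\omega\ge 1$, $N\in\mathbb N$ and $m\in\{1,\dots,\lfloor N/2\rfloor\}$, $$\alpha_{N,m}^\omega\le\alpha_{N,N-m}^\omega ,$$ and for $\omega=1$ equality holds: $\alpha_{N,m}^1=\alpha_{N,N-m}^1$. -/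

import Mathlib

open Filter Topology

/-- Class `K_∞`: continuous functions `ρ : [0,∞) → [0,∞)` with `ρ 0 = 0` that are strictly
increasing and unbounded. (Functions on `[0,∞)` are represented by functions on `ℝ` of which
only the values on `[0,∞)` matter.) -/
structure IsClassKInfty (ρ : ℝ → ℝ) : Prop where
  continuousOn : ContinuousOn ρ (Set.Ici 0)
  map_zero : ρ 0 = 0
  strictMonoOn : StrictMonoOn ρ (Set.Ici 0)
  unbounded : ∀ M : ℝ, ∃ r : ℝ, 0 ≤ r ∧ M < ρ r

/-- Class `KL₀`: continuous functions `β : [0,∞) × [0,∞) → [0,∞)` such that `β(r,t) → 0` as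
`t → ∞` for each `r > 0` and, for each `t ≥ 0`, either `β(·,t)` is of class `K_∞` or
`β(·,t) ≡ 0`. -/
structure IsClassKL0 (β : ℝ → ℝ → ℝ) : Prop where
  nonneg : ∀ r t : ℝ, 0 ≤ r → 0 ≤ t → 0 ≤ β r t
  continuousOn : ContinuousOn (fun p : ℝ × ℝ => β p.1 p.2) (Set.Ici 0 ×ˢ Set.Ici 0)
  tendsto_zero : ∀ r : ℝ, 0 < r → Tendsto (fun t => β r t) atTop (𝓝 0)
  kInfty_or_zero : ∀ t : ℝ, 0 ≤ t →
    IsClassKInfty (fun r => β r t) ∨ ∀ r : ℝ, 0 ≤ r → β r t = 0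

/-- Exponential controllability: `β(r,n) = C σⁿ r` with `C ≥ 1` and `σ ∈ (0,1)`. -/
def IsExponentialType (β : ℝ → ℝ → ℝ) : Prop :=
  ∃ C σ : ℝ, 1 ≤ C ∧ 0 < σ ∧ σ < 1 ∧
    ∀ (r : ℝ) (n : ℕ), 0 ≤ r → β r n = C * σ ^ n * r

/-- Finite time controllability with linear overshoot and coefficients `c`: `β(r,n) = cₙ r`,
where `cₙ ≥ 0` and `cₙ = 0` for all sufficiently large `n`. -/
def IsFiniteTimeType (β : ℝ → ℝ → ℝ) (c : ℕ → ℝ) : Prop :=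
  (∀ n, 0 ≤ c n) ∧ (∃ n₀ : ℕ, ∀ n, n₀ ≤ n → c n = 0) ∧
    ∀ (r : ℝ) (n : ℕ), 0 ≤ r → β r n = c n * r

/-- The submultiplicativity property `β(r, n+m) ≤ β(β(r,n), m)` for `r ≥ 0`, `n, m ∈ ℕ₀`. -/
def IsSubmultiplicative (β : ℝ → ℝ → ℝ) : Prop :=
  ∀ (r : ℝ) (n m : ℕ), 0 ≤ r → β r ((n + m : ℕ) : ℝ) ≤ β (β r n) m

/-- `B_k(r) = ∑_{n=0}^{k-2} β(r,n) + ω β(r,k-1)`, for `k ≥ 1`. -/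
def boundB (β : ℝ → ℝ → ℝ) (ω : ℝ) (k : ℕ) (r : ℝ) : ℝ :=
  (∑ n ∈ Finset.range (k - 1), β r n) + ω * β r ((k - 1 : ℕ) : ℝ)

/-- The weighted tail cost `∑_{n=k}^{N-2} lₙ + ω l_{N-1}`. -/
def tailCost (ω : ℝ) (N : ℕ) (l : ℕ → ℝ) (k : ℕ) : ℝ :=
  (∑ n ∈ Finset.Ico k (N - 1), l n) + ω * l (N - 1)

/-- Feasibility of `(l₀, …, l_{N-1}, ν)` in the optimization problem for the optimization
horizon `N`, the control horizon `m` and the final weight `ω`. Only the entries `l n` with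
`n < N` are involved. -/
structure IsFeasible (β : ℝ → ℝ → ℝ) (ω : ℝ) (N m : ℕ) (l : ℕ → ℝ) (ν : ℝ) : Prop where
  pos : ∀ n, n < N → 0 < l n
  nu_pos : 0 < ν
  tail_le : ∀ k, k + 2 ≤ N → tailCost ω N l k ≤ boundB β ω (N - k) (l k)
  nu_le : ∀ j, j + m + 1 ≤ N →
    ν ≤ (∑ n ∈ Finset.range j, l (n + m)) + boundB β ω (N - j) (l (j + m))

/-- The optimal value `α_{N,m}^ω`: the infimum of
`(∑_{n=0}^{N-2} lₙ + ω l_{N-1} - ν) / ∑_{n=0}^{m-1} lₙ` over all feasible `(l, ν)`, taken in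
the extended reals (so that the infimum over an infeasible problem is `+∞`). -/
noncomputable def optValue (β : ℝ → ℝ → ℝ) (ω : ℝ) (N m : ℕ) : EReal :=
  sInf {a : EReal | ∃ (l : ℕ → ℝ) (ν : ℝ), IsFeasible β ω N m l ν ∧
    a = (((tailCost ω N l 0 - ν) / ∑ n ∈ Finset.range m, l n : ℝ) : EReal)}

/-! Since β is linear in r, the data enter only through the numbers γ_k = `growthBound c ω k`. Write
T_k for the tail costs and D = ν - T_m; the objective equals 1 - D / ∑_{n<m} λ_n. The constraint T_k
≤ γ_{N-k} λ_k says that T contracts by 1 - 1/γ_{N-k}, and the constraints on ν say that D + T_{m+j}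
contracts by 1 - 1/γ_{N-j}, with initial value ν and with ω/γ_{m+1} in place of 1/γ_{m+1} at the
end. Hence T_m ≤ q T_0 and D ≤ Q ν, so the objective is at least 1 - Qq / ((1-Q)(1-q)), which is
`IsFeasible.one_sub_gap_le_objective`. Submultiplicativity makes the sequence that attains these
contractions feasible (`isFeasible_optimalStageCost`), so `optValue_eq` is a closed formula.

With M = N - m, G = γ_{m+1}, H = γ_{M+1}, and x, y the contractions over M and m steps, Q is x
(G-ω)/(G-1) for horizon m and y (H-ω)/(H-1) for horizon M. For ω = 1 the formula is symmetric in x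
and y, which gives equality. In general `performanceGap_le` reduces the claim to (H-ω)(1-y) ≤
(G-ω)(1-x). This is immediate if ω < H ≤ G, because x ≤ y. In the exponential case it is an identity
for C = 1 and follows for C ≥ 1 from two chord inequalities for ∏ (1 - t u_i) with t = 1/C. In the
finite-time case only m = 1 is not immediate, and c_2 ≤ c_1² settles it.

Degenerate cases: if some γ_i ≤ 1, both problems are infeasible; if H ≤ ω, the value for M is at
least 1 and the value for m at most 1. -/

/-- The bound `∑_{n=0}^{k-2} cₙ + ω c_{k-1}` on the weighted cost of horizon `k` per unit of
initial stage cost. -/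
def growthBound (c : ℕ → ℝ) (ω : ℝ) (k : ℕ) : ℝ :=
  (∑ n ∈ Finset.range (k - 1), c n) + ω * c (k - 1)

/-- The contraction `∏_{k<n} (1 - 1/γ_{N-k})` of the tail cost over `n` steps. -/
noncomputable def tailDecay (γ : ℕ → ℝ) (N n : ℕ) : ℝ :=
  ∏ k ∈ Finset.range n, (1 - 1 / γ (N - k))

/-- The quantity `∏_{k<N-m-1} (1 - 1/γ_{N-k}) (1 - ω/γ_{m+1})`. -/
noncomputable def shiftedDecay (γ : ℕ → ℝ) (ω : ℝ) (N m : ℕ) : ℝ :=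
  tailDecay γ N (N - m - 1) * (1 - ω / γ (m + 1))

theorem growthBound_succ (c : ℕ → ℝ) (ω : ℝ) (k : ℕ) :
    growthBound c ω (k + 1) = (∑ n ∈ Finset.range k, c n) + ω * c k := rfl

theorem boundB_eq {β : ℝ → ℝ → ℝ} {c : ℕ → ℝ}
    (h : ∀ (r : ℝ) (n : ℕ), 0 ≤ r → β r n = c n * r) (ω : ℝ) (k : ℕ) {r : ℝ} (hr : 0 ≤ r) :
    boundB β ω k r = growthBound c ω k * r := by
  unfold boundB growthBound
  rw [add_mul, Finset.sum_mul, h r _ hr]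
  simp only [h r _ hr]
  ring

/-! ### Tail costs -/

theorem tailCost_last (ω : ℝ) (N : ℕ) (l : ℕ → ℝ) :
    tailCost ω N l (N - 1) = ω * l (N - 1) := by
  simp [tailCost]

theorem tailCost_eq_add {ω : ℝ} {N k : ℕ} (l : ℕ → ℝ) (hk : k + 2 ≤ N) :
    tailCost ω N l k = l k + tailCost ω N l (k + 1) := by
  unfold tailCost
  rw [Finset.sum_eq_sum_Ico_succ_bot (by omega : k < N - 1)]
  ring

theorem tailCost_zero {ω : ℝ} {N m : ℕ} (l : ℕ → ℝ) (hm : m + 1 ≤ N) :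
    tailCost ω N l 0 = ∑ n ∈ Finset.range m, l n + tailCost ω N l m := by
  unfold tailCost
  rw [← add_assoc, Finset.range_eq_Ico, Finset.sum_Ico_consecutive _ (by omega) (by omega)]

theorem tailCost_eq_of_recursion {ω : ℝ} {N : ℕ} (l T : ℕ → ℝ)
    (hlast : T (N - 1) = ω * l (N - 1)) (hstep : ∀ k, k + 2 ≤ N → T k = l k + T (k + 1))
    {k : ℕ} (hk : k + 1 ≤ N) : tailCost ω N l k = T k := by
  obtain ⟨d, rfl⟩ : ∃ d, N = k + d + 1 := ⟨N - k - 1, by omega⟩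
  induction d generalizing k with
  | zero => simpa [tailCost] using hlast.symm
  | succ d ih =>
    rw [tailCost_eq_add l (by omega), hstep k (by omega)]
    have e : k + 1 + d + 1 = k + (d + 1) + 1 := by ring
    have := @ih (k + 1) (by rw [e]; exact hlast) (by rw [e]; exact hstep) (by omega)
    rw [e] at this
    rw [this]

theorem tailCost_pos {ω : ℝ} {N : ℕ} {l : ℕ → ℝ} (hω : 1 ≤ ω) (hl : ∀ n, n < N → 0 < l n)
    (k : ℕ) (hN : 1 ≤ N) : 0 < tailCost ω N l k := by
  unfold tailCost
  have h1 : 0 ≤ ∑ n ∈ Finset.Ico k (N - 1), l n :=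
    Finset.sum_nonneg fun n hn => (hl n (by have := Finset.mem_Ico.1 hn; omega)).le
  have h2 := hl (N - 1) (by omega)
  have : 0 < ω * l (N - 1) := by positivity
  linarith

/-! ### Decay factors -/

theorem tailDecay_zero (γ : ℕ → ℝ) (N : ℕ) : tailDecay γ N 0 = 1 := by simp [tailDecay]

theorem tailDecay_succ (γ : ℕ → ℝ) (N n : ℕ) :
    tailDecay γ N (n + 1) = tailDecay γ N n * (1 - 1 / γ (N - n)) := by
  simp [tailDecay, Finset.prod_range_succ]

theorem one_sub_one_div_mem {x : ℝ} (hx : 1 < x) : 0 < 1 - 1 / x ∧ 1 - 1 / x < 1 := by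
  have h0 : 0 < 1 / x := by positivity
  have h1 : 1 / x < 1 := by rw [div_lt_one (by linarith)]; exact hx
  constructor <;> linarith

theorem tailDecay_pos {γ : ℕ → ℝ} {N n : ℕ} (hγ : ∀ i, 2 ≤ i → i ≤ N → 1 < γ i)
    (hn : n + 1 ≤ N) : 0 < tailDecay γ N n :=
  Finset.prod_pos fun k hk => by
    have := Finset.mem_range.1 hk
    exact (one_sub_one_div_mem (hγ (N - k) (by omega) (by omega))).1

theorem tailDecay_anti {γ : ℕ → ℝ} {N n k : ℕ} (hγ : ∀ i, 2 ≤ i → i ≤ N → 1 < γ i)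
    (hnk : n ≤ k) (hk : k + 1 ≤ N) : tailDecay γ N k ≤ tailDecay γ N n := by
  induction k, hnk using Nat.le_induction with
  | base => exact le_rfl
  | succ k hnk ih =>
    refine le_trans ?_ (ih (by omega))
    rw [tailDecay_succ]
    exact mul_le_of_le_one_right (tailDecay_pos hγ (by omega)).le
      (one_sub_one_div_mem (hγ (N - k) (by omega) (by omega))).2.le

theorem tailDecay_lt_one {γ : ℕ → ℝ} {N n : ℕ} (hγ : ∀ i, 2 ≤ i → i ≤ N → 1 < γ i)
    (hn1 : 1 ≤ n) (hn : n + 1 ≤ N) : tailDecay γ N n < 1 := by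
  refine (tailDecay_anti hγ hn1 hn).trans_lt ?_
  rw [tailDecay_succ, tailDecay_zero, one_mul]
  exact (one_sub_one_div_mem (hγ N (by omega) le_rfl)).2

theorem tailDecay_div {γ : ℕ → ℝ} {N n : ℕ} :
    tailDecay γ N n / γ (N - n) = tailDecay γ N n - tailDecay γ N (n + 1) := by
  rw [tailDecay_succ]; ring

theorem shiftedDecay_lt_one {γ : ℕ → ℝ} {ω : ℝ} {N m : ℕ}
    (hγ : ∀ i, 2 ≤ i → i ≤ N → 1 < γ i) (hω : 1 ≤ ω) (hm : 1 ≤ m) (hmN : m + 1 ≤ N) :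
    shiftedDecay γ ω N m < 1 := by
  have hg := hγ (m + 1) (by omega) (by omega)
  have hq := tailDecay_pos (n := N - m - 1) hγ (by omega)
  have hq1 : tailDecay γ N (N - m - 1) ≤ 1 := by
    simpa [tailDecay_zero] using tailDecay_anti (n := 0) (k := N - m - 1) hγ (by omega) (by omega)
  have : 0 < ω / γ (m + 1) := by positivity
  unfold shiftedDecay
  nlinarith

/-- Only the last factor of the contraction over N - m steps is altered. This form shows the
symmetry between m and N - m; the coefficient is 1 when ω = 1. -/
theorem shiftedDecay_eq {γ : ℕ → ℝ} {ω : ℝ} {N m : ℕ} (hmN : m + 1 ≤ N)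
    (hg : 1 < γ (m + 1)) :
    shiftedDecay γ ω N m =
      (γ (m + 1) - ω) / (γ (m + 1) - 1) * tailDecay γ N (N - m) := by
  obtain ⟨d, rfl⟩ : ∃ d, N = m + 1 + d := ⟨N - m - 1, by omega⟩
  have e1 : m + 1 + d - m - 1 = d := by omega
  have e2 : m + 1 + d - m = d + 1 := by omega
  have e3 : m + 1 + d - d = m + 1 := by omega
  rw [shiftedDecay, e1, e2, tailDecay_succ, e3]
  have : γ (m + 1) - 1 ≠ 0 := by linarith
  have : γ (m + 1) ≠ 0 := by linarith
  field_simp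

/-- The upper bound on `1 - α` for control horizon `m`. -/
noncomputable def performanceGap (γ : ℕ → ℝ) (ω : ℝ) (N m : ℕ) : ℝ :=
  shiftedDecay γ ω N m * tailDecay γ N m /
    ((1 - shiftedDecay γ ω N m) * (1 - tailDecay γ N m))

/-! ### Lower bounds for the optimal value -/

section LowerBound

variable {β : ℝ → ℝ → ℝ} {c : ℕ → ℝ} {ω : ℝ} {N m : ℕ} {l : ℕ → ℝ} {ν : ℝ}

theorem IsFeasible.sum_pos (hf : IsFeasible β ω N m l ν) (hm : 1 ≤ m) (hmN : m + 1 ≤ N) :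
    0 < ∑ n ∈ Finset.range m, l n :=
  Finset.sum_pos (fun n hn => hf.pos n (by have := Finset.mem_range.1 hn; omega))
    ⟨0, by simpa using by omega⟩

/-- In the tail constraint at k = N - i, the left side exceeds λ_k by a positive remaining tail. -/
theorem IsFeasible.one_lt_growthBound (hβ : ∀ (r : ℝ) (n : ℕ), 0 ≤ r → β r n = c n * r)
    (hω : 1 ≤ ω) (hf : IsFeasible β ω N m l ν) {i : ℕ} (hi : 2 ≤ i) (hiN : i ≤ N) :
    1 < growthBound c ω i := by
  have h := hf.tail_le (N - i) (by omega)
  have hl := hf.pos (N - i) (by omega)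
  rw [boundB_eq hβ ω _ hl.le, tailCost_eq_add l (by omega), (by omega : N - (N - i) = i)] at h
  have := tailCost_pos hω hf.pos (N - i + 1) (by omega)
  by_contra hc
  nlinarith

theorem IsFeasible.gap_le_last (hβ : ∀ (r : ℝ) (n : ℕ), 0 ≤ r → β r n = c n * r)
    (hf : IsFeasible β ω N m l ν) (hmN : m + 1 ≤ N) {j : ℕ} (hj : j + m + 1 ≤ N) :
    ν - tailCost ω N l m + tailCost ω N l (m + j) ≤ growthBound c ω (N - j) * l (m + j) := by
  have h := hf.nu_le j hj
  rw [boundB_eq hβ ω _ (hf.pos _ (by omega)).le] at h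
  have h2 := tailCost_zero (ω := ω) (N := N) l (m := m) (by omega)
  have h3 := tailCost_zero (ω := ω) (N := N) l (m := m + j) (by omega)
  rw [Finset.sum_range_add] at h3
  simp only [add_comm _ m] at h
  linarith

/-- Each constraint on ν bounds λ_{m+j} below by a fraction of D + T_{m+j}, and subtracting λ_{m+j}
gives the next term. In the final step ωλ_{N-1} is subtracted, so ω < γ_{m+1} is needed to keep the
factor positive. -/
theorem IsFeasible.gap_le_shiftedDecay_mul
    (hβ : ∀ (r : ℝ) (n : ℕ), 0 ≤ r → β r n = c n * r) (hω : 1 ≤ ω)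
    (hf : IsFeasible β ω N m l ν) (hm : 1 ≤ m) (hmN : m + 1 ≤ N)
    (hg : ω < growthBound c ω (m + 1)) :
    ν - tailCost ω N l m ≤ shiftedDecay (growthBound c ω) ω N m * ν := by
  have hγ : ∀ i, 2 ≤ i → i ≤ N → 1 < growthBound c ω i := fun i h1 h2 =>
    hf.one_lt_growthBound hβ hω h1 h2
  set γ := growthBound c ω with hγdef
  set D := ν - tailCost ω N l m with hD
  have key : ∀ j, j + m + 1 ≤ N → D + tailCost ω N l (m + j) ≤ tailDecay γ N j * ν := by
    intro j
    induction j with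
    | zero => intro _; rw [tailDecay_zero, hD]; simp
    | succ j ih =>
      intro hj
      have h1 := ih (by omega)
      have h2 := hf.gap_le_last hβ hmN (j := j) (by omega)
      rw [← hD, ← hγdef] at h2
      have h3 := hγ (N - j) (by omega) (by omega)
      have h4 := tailCost_eq_add (ω := ω) l (k := m + j) (N := N) (by omega)
      have h5 := one_sub_one_div_mem h3
      have h6 : (D + tailCost ω N l (m + j)) / γ (N - j) ≤ l (m + j) := by
        rw [div_le_iff₀ (by linarith)]; linarith
      calc D + tailCost ω N l (m + (j + 1))
          = D + tailCost ω N l (m + j) - l (m + j) := by rw [h4, ← add_assoc]; ring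
        _ ≤ (1 - 1 / γ (N - j)) * (D + tailCost ω N l (m + j)) := by
          have : (1 - 1 / γ (N - j)) * (D + tailCost ω N l (m + j)) =
            D + tailCost ω N l (m + j) - (D + tailCost ω N l (m + j)) / γ (N - j) := by ring
          linarith
        _ ≤ (1 - 1 / γ (N - j)) * (tailDecay γ N j * ν) :=
          mul_le_mul_of_nonneg_left h1 h5.1.le
        _ = tailDecay γ N (j + 1) * ν := by rw [tailDecay_succ]; ring
  have h1 := key (N - m - 1) (by omega)
  have h2 := hf.gap_le_last hβ hmN (j := N - m - 1) (by omega)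
  have e1 : m + (N - m - 1) = N - 1 := by omega
  have e2 : N - (N - m - 1) = m + 1 := by omega
  rw [e1, tailCost_last] at h1
  rw [← hD, ← hγdef, e1, e2, tailCost_last] at h2
  have hpos : 0 < γ (m + 1) := by linarith
  have h3 : 0 < 1 - ω / γ (m + 1) := by
    have : ω / γ (m + 1) < 1 := (div_lt_one hpos).2 hg
    linarith
  have h4 : D ≤ (1 - ω / γ (m + 1)) * (D + ω * l (N - 1)) := by
    have h5 : (D + ω * l (N - 1)) / γ (m + 1) ≤ l (N - 1) := by
      rw [div_le_iff₀ hpos]; linarith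
    have h6 := mul_le_mul_of_nonneg_left h5 (by linarith : (0:ℝ) ≤ ω)
    have : (1 - ω / γ (m + 1)) * (D + ω * l (N - 1)) =
      D + ω * l (N - 1) - ω * ((D + ω * l (N - 1)) / γ (m + 1)) := by ring
    linarith
  calc D ≤ (1 - ω / γ (m + 1)) * (D + ω * l (N - 1)) := h4
    _ ≤ (1 - ω / γ (m + 1)) * (tailDecay γ N (N - m - 1) * ν) :=
      mul_le_mul_of_nonneg_left h1 h3.le
    _ = shiftedDecay γ ω N m * ν := by rw [shiftedDecay]; ring

theorem IsFeasible.tailCost_le_tailDecay_mul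
    (hβ : ∀ (r : ℝ) (n : ℕ), 0 ≤ r → β r n = c n * r) (hω : 1 ≤ ω)
    (hf : IsFeasible β ω N m l ν) {k : ℕ} (hk : k + 1 ≤ N) :
    tailCost ω N l k ≤ tailDecay (growthBound c ω) N k * tailCost ω N l 0 := by
  induction k with
  | zero => rw [tailDecay_zero, one_mul]
  | succ k ih =>
    have h1 := ih (by omega)
    have h2 := hf.tail_le k (by omega)
    rw [boundB_eq hβ ω _ (hf.pos _ (by omega)).le] at h2
    have h3 := hf.one_lt_growthBound hβ hω (i := N - k) (by omega) (by omega)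
    have h4 := tailCost_eq_add (ω := ω) l (k := k) (N := N) (by omega)
    set g := growthBound c ω (N - k)
    have h5 := one_sub_one_div_mem h3
    have h6 : tailCost ω N l k / g ≤ l k := by
      rw [div_le_iff₀ (by linarith)]; linarith
    calc tailCost ω N l (k + 1) = tailCost ω N l k - l k := by rw [h4]; ring
      _ ≤ (1 - 1 / g) * tailCost ω N l k := by
        have : (1 - 1 / g) * tailCost ω N l k = tailCost ω N l k - tailCost ω N l k / g := by
          ring
        linarith
      _ ≤ (1 - 1 / g) * (tailDecay (growthBound c ω) N k * tailCost ω N l 0) :=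
        mul_le_mul_of_nonneg_left h1 h5.1.le
      _ = _ := by rw [tailDecay_succ]; ring

/-- The last constraint on ν reads D + ωλ_{N-1} ≤ γ_{m+1} λ_{N-1}, which forces D ≤ 0. -/
theorem IsFeasible.one_le_objective (hβ : ∀ (r : ℝ) (n : ℕ), 0 ≤ r → β r n = c n * r)
    (hf : IsFeasible β ω N m l ν) (hm : 1 ≤ m) (hmN : m + 1 ≤ N)
    (hg : growthBound c ω (m + 1) ≤ ω) :
    1 ≤ (tailCost ω N l 0 - ν) / ∑ n ∈ Finset.range m, l n := by
  rw [le_div_iff₀ (hf.sum_pos hm hmN), tailCost_zero l hmN]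
  have h2 := hf.gap_le_last hβ hmN (j := N - m - 1) (by omega)
  rw [(by omega : m + (N - m - 1) = N - 1), (by omega : N - (N - m - 1) = m + 1),
    tailCost_last] at h2
  have := hf.pos (N - 1) (by omega)
  nlinarith

theorem IsFeasible.one_sub_gap_le_objective
    (hβ : ∀ (r : ℝ) (n : ℕ), 0 ≤ r → β r n = c n * r) (hω : 1 ≤ ω)
    (hf : IsFeasible β ω N m l ν) (hm : 1 ≤ m) (hmN : m + 1 ≤ N)
    (hg : ω < growthBound c ω (m + 1)) :
    1 - performanceGap (growthBound c ω) ω N m ≤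
      (tailCost ω N l 0 - ν) / ∑ n ∈ Finset.range m, l n := by
  have hγ : ∀ i, 2 ≤ i → i ≤ N → 1 < growthBound c ω i := fun i h1 h2 =>
    hf.one_lt_growthBound hβ hω h1 h2
  have hS := hf.sum_pos hm hmN
  have h1 := hf.gap_le_shiftedDecay_mul hβ hω hm hmN hg
  have h2 := hf.tailCost_le_tailDecay_mul hβ hω hmN
  have h3 := tailCost_zero (ω := ω) l hmN
  have hQ1 := shiftedDecay_lt_one hγ hω hm hmN
  have hQ0 : 0 < shiftedDecay (growthBound c ω) ω N m := by
    have : ω / growthBound c ω (m + 1) < 1 := (div_lt_one (by linarith)).2 hg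
    exact mul_pos (tailDecay_pos hγ (by omega)) (by linarith)
  have hq1 := tailDecay_lt_one hγ hm hmN
  have hT := tailCost_pos hω hf.pos m (by omega)
  unfold performanceGap
  set γ := growthBound c ω
  set Q := shiftedDecay γ ω N m
  set q := tailDecay γ N m
  set S := ∑ n ∈ Finset.range m, l n
  set T := tailCost ω N l m
  rw [le_div_iff₀ hS, sub_mul, h3, one_mul]
  have h4 : (ν - T) * (1 - Q) ≤ Q * T := by nlinarith
  have h5 : T * (1 - q) ≤ q * S := by rw [h3] at h2; nlinarith
  have h6 : (ν - T) * ((1 - Q) * (1 - q)) ≤ Q * q * S := by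
    have := mul_le_mul_of_nonneg_right h4 (by linarith : 0 ≤ 1 - q)
    have := mul_le_mul_of_nonneg_left h5 hQ0.le
    nlinarith
  have h7 : ν - T ≤ Q * q / ((1 - Q) * (1 - q)) * S := by
    rw [div_mul_eq_mul_div, le_div_iff₀ (mul_pos (by linarith) (by linarith))]
    exact h6
  linarith

end LowerBound

/-! ### Attaining the bound -/

theorem growthBound_add_le {c : ℕ → ℝ} {ω : ℝ} (hc : ∀ n k, c (n + k) ≤ c n * c k)
    (hω : 0 ≤ ω) (s K : ℕ) :
    growthBound c ω (s + K + 1) ≤ ∑ n ∈ Finset.range s, c n + c s * growthBound c ω (K + 1) := by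
  rw [growthBound_succ, growthBound_succ, Finset.sum_range_add, mul_add, Finset.mul_sum]
  have h1 : ∑ n ∈ Finset.range K, c (s + n) ≤ ∑ n ∈ Finset.range K, c s * c n :=
    Finset.sum_le_sum fun n _ => hc s n
  have h2 := mul_le_mul_of_nonneg_left (hc s K) hω
  nlinarith

/-- If the cost-to-go bounds of horizon `m + i` are tight along the last `e + 1` stage costs up
to a common constant `D`, then submultiplicativity yields the bound of horizon `e + 1`. -/
theorem tail_le_growthBound_mul {c : ℕ → ℝ} {ω D : ℝ} {m e : ℕ} {x t : ℕ → ℝ}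
    (hc : ∀ n k, c (n + k) ≤ c n * c k) (hω : 0 ≤ ω) (hx : 0 ≤ x 0)
    (hg1 : ∀ i, i ≤ e → 1 ≤ growthBound c ω (m + i + 1)) (hgω : ω ≤ growthBound c ω (m + 1))
    (hlast : t e = ω * x e) (hstep : ∀ s, s < e → t s = x s + t (s + 1))
    (htight : ∀ s, s ≤ e → D + t s = growthBound c ω (m + (e - s) + 1) * x s) :
    t 0 ≤ growthBound c ω (e + 1) * x 0 := by
  -- Tightness at 0, with the horizon m + e + 1 cut after s steps by submultiplicativity.
  have split : ∀ s, s ≤ e → D + t 0 ≤ (∑ n ∈ Finset.range s, c n) * x 0 +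
      growthBound c ω (m + (e - s) + 1) * (c s * x 0) := by
    intro s hs
    have h := growthBound_add_le hc hω s (m + (e - s))
    rw [(by omega : s + (m + (e - s)) + 1 = m + (e - 0) + 1)] at h
    have h2 := mul_le_mul_of_nonneg_right h hx
    rw [htight 0 (by omega)]
    linarith
  -- Backward induction on s. As long as x_s ≤ c_s x_0, the tail bound accumulates. If x_s > c_s
  -- x_0, subtracting tightness at s from `split` leaves an excess (x_s - c_s x_0)(1 - γ) ≤ 0, with
  -- ω - γ instead at s = e, so the claim follows at once.
  have key : ∀ d s, s + d = e → t 0 ≤ growthBound c ω (e + 1) * x 0 ∨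
      t s ≤ (growthBound c ω (e + 1) - ∑ n ∈ Finset.range s, c n) * x 0 := by
    intro d
    induction d with
    | zero =>
      rintro s rfl
      simp only [add_zero] at *
      rcases le_or_gt (x s) (c s * x 0) with h | h
      · right
        rw [hlast, growthBound_succ]
        have := mul_le_mul_of_nonneg_left h hω
        linarith
      · left
        have h1 := split s le_rfl
        have h2 := htight s le_rfl
        rw [Nat.sub_self, add_zero] at h1 h2
        have h3 := mul_le_mul_of_nonneg_left h.le (sub_nonneg.2 hgω)
        rw [growthBound_succ]
        linarith
    | succ d ih =>
      intro s hs
      rcases ih (s + 1) (by omega) with h | h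
      · exact Or.inl h
      · rw [Finset.sum_range_succ] at h
        have hst := hstep s (by omega)
        rcases le_or_gt (x s) (c s * x 0) with hb | hb
        · right; linarith
        · left
          have h1 := split s (by omega)
          have h2 := htight s (by omega)
          have h3 := mul_le_mul_of_nonneg_left hb.le (sub_nonneg.2 (hg1 (e - s) (by omega)))
          linarith
  rcases key e 0 (by omega) with h | h
  · exact h
  · simpa using h

/-- The stage costs for which the lower bound on the objective is attained. -/
noncomputable def optimalStageCost (γ : ℕ → ℝ) (ω : ℝ) (N m n : ℕ) : ℝ :=
  if n < m then
    (1 - shiftedDecay γ ω N m) / tailDecay γ N m * (tailDecay γ N n / γ (N - n))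
  else tailDecay γ N (n - m) / γ (N - (n - m))

/-- The tail costs of `optimalStageCost`. -/
noncomputable def optimalTailCost (γ : ℕ → ℝ) (ω : ℝ) (N m n : ℕ) : ℝ :=
  if n < m then (1 - shiftedDecay γ ω N m) / tailDecay γ N m * tailDecay γ N n
  else tailDecay γ N (n - m) - shiftedDecay γ ω N m

section Attained

variable {γ : ℕ → ℝ} {ω : ℝ} {N m : ℕ}

theorem optimalTailCost_last (hmN : m + 1 ≤ N) :
    optimalTailCost γ ω N m (N - 1) = ω * optimalStageCost γ ω N m (N - 1) := by
  unfold optimalTailCost optimalStageCost shiftedDecay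
  rw [if_neg (by omega), if_neg (by omega), (by omega : N - 1 - m = N - m - 1),
    (by omega : N - (N - m - 1) = m + 1)]
  ring

theorem optimalTailCost_step (hγ : ∀ i, 2 ≤ i → i ≤ N → 1 < γ i) (hmN : m + 1 ≤ N) {k : ℕ} :
    optimalTailCost γ ω N m k =
      optimalStageCost γ ω N m k + optimalTailCost γ ω N m (k + 1) := by
  unfold optimalTailCost optimalStageCost
  rcases lt_trichotomy (k + 1) m with h | h | h
  · rw [if_pos (by omega), if_pos (by omega), if_pos (by omega), tailDecay_div]
    ring
  · rw [if_pos (by omega), if_pos (by omega), if_neg (by omega), tailDecay_div, h,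
      Nat.sub_self, tailDecay_zero]
    have := tailDecay_pos (n := m) hγ hmN
    field_simp
    ring
  · rw [if_neg (by omega), if_neg (by omega), if_neg (by omega), tailDecay_div,
      (by omega : k + 1 - m = k - m + 1)]
    ring

theorem tailCost_optimalStageCost (hγ : ∀ i, 2 ≤ i → i ≤ N → 1 < γ i) (hmN : m + 1 ≤ N)
    {k : ℕ} (hk : k + 1 ≤ N) :
    tailCost ω N (optimalStageCost γ ω N m) k = optimalTailCost γ ω N m k :=
  tailCost_eq_of_recursion _ (optimalTailCost γ ω N m) (optimalTailCost_last hmN)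
    (fun _ _ => optimalTailCost_step hγ hmN) hk

theorem optimalStageCost_pos (hγ : ∀ i, 2 ≤ i → i ≤ N → 1 < γ i) (hω : 1 ≤ ω) (hm : 1 ≤ m)
    (hmN : m + 1 ≤ N) {n : ℕ} (hn : n < N) : 0 < optimalStageCost γ ω N m n := by
  have hQ := shiftedDecay_lt_one hγ hω hm hmN
  unfold optimalStageCost
  split_ifs with h
  · exact mul_pos (div_pos (by linarith) (tailDecay_pos hγ hmN))
      (div_pos (tailDecay_pos hγ (by omega)) (by linarith [hγ (N - n) (by omega) (by omega)]))
  · exact div_pos (tailDecay_pos hγ (by omega))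
      (by linarith [hγ (N - (n - m)) (by omega) (by omega)])

end Attained

/-- All constraints on ν = 1 are equalities by telescoping, as are the tail constraints with k < m.
For k ≥ m the tail constraints are not built in; `tail_le_growthBound_mul` derives them from the
tight ν constraints, with D = Q. -/
theorem isFeasible_optimalStageCost {β : ℝ → ℝ → ℝ} {c : ℕ → ℝ} {ω : ℝ} {N m : ℕ}
    (hβ : ∀ (r : ℝ) (n : ℕ), 0 ≤ r → β r n = c n * r) (hc : ∀ n k, c (n + k) ≤ c n * c k)
    (hω : 1 ≤ ω) (hm : 1 ≤ m) (hmN : m + 1 ≤ N)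
    (hγ : ∀ i, 2 ≤ i → i ≤ N → 1 < growthBound c ω i) (hg : ω ≤ growthBound c ω (m + 1)) :
    IsFeasible β ω N m (optimalStageCost (growthBound c ω) ω N m) 1 := by
  set γ := growthBound c ω with hγdef
  have hpos : ∀ n, n < N → 0 < optimalStageCost γ ω N m n := fun n hn =>
    optimalStageCost_pos hγ hω hm hmN hn
  refine ⟨hpos, one_pos, fun k hk => ?_, fun j hj => ?_⟩
  · rw [tailCost_optimalStageCost hγ hmN (by omega), boundB_eq hβ ω _ (hpos k (by omega)).le,
      ← hγdef]
    by_cases hkm : k < m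
    · unfold optimalTailCost optimalStageCost
      rw [if_pos hkm, if_pos hkm]
      have := hγ (N - k) (by omega) (by omega)
      apply le_of_eq
      field_simp
    · have := tail_le_growthBound_mul (c := c) (ω := ω) (D := shiftedDecay γ ω N m) (m := m)
        (e := N - k - 1) (x := fun s => optimalStageCost γ ω N m (k + s))
        (t := fun s => optimalTailCost γ ω N m (k + s)) hc (by linarith)
        (hpos k (by omega)).le (fun i hi => (hγ (m + i + 1) (by omega) (by omega)).le) hg
        (by
          rw [(by omega : k + (N - k - 1) = N - 1)]
          exact optimalTailCost_last hmN)
        (fun s hs => optimalTailCost_step hγ hmN)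
        (fun s hs => by
          rw [← hγdef]
          unfold optimalTailCost optimalStageCost
          rw [if_neg (by omega), if_neg (by omega),
            (by omega : m + (N - k - 1 - s) + 1 = N - (k + s - m))]
          have := hγ (N - (k + s - m)) (by omega) (by omega)
          field_simp
          ring)
      rw [(by omega : N - k - 1 + 1 = N - k)] at this
      exact this
  · rw [boundB_eq hβ ω _ (hpos _ (by omega)).le, ← hγdef]
    have h1 : ∀ n, optimalStageCost γ ω N m (n + m) =
        tailDecay γ N n - tailDecay γ N (n + 1) := fun n => by
      rw [← tailDecay_div, optimalStageCost, if_neg (by omega), Nat.add_sub_cancel]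
    have h2 : γ (N - j) * optimalStageCost γ ω N m (j + m) = tailDecay γ N j := by
      rw [optimalStageCost, if_neg (by omega), Nat.add_sub_cancel]
      have := hγ (N - j) (by omega) (by omega)
      field_simp
    rw [h2, Finset.sum_congr rfl fun n _ => h1 n, Finset.sum_range_sub', tailDecay_zero]
    linarith

theorem objective_optimalStageCost {γ : ℕ → ℝ} {ω : ℝ} {N m : ℕ}
    (hγ : ∀ i, 2 ≤ i → i ≤ N → 1 < γ i) (hω : 1 ≤ ω) (hm : 1 ≤ m) (hmN : m + 1 ≤ N) :
    (tailCost ω N (optimalStageCost γ ω N m) 0 - 1) /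
      ∑ n ∈ Finset.range m, optimalStageCost γ ω N m n = 1 - performanceGap γ ω N m := by
  have h0 := tailCost_optimalStageCost (ω := ω) hγ hmN (k := 0) (by omega)
  have h1 := tailCost_optimalStageCost (ω := ω) hγ hmN (k := m) (by omega)
  have h2 := tailCost_zero (ω := ω) (optimalStageCost γ ω N m) hmN
  have hQ := shiftedDecay_lt_one hγ hω hm hmN
  have hq1 := tailDecay_lt_one hγ hm hmN
  have hq0 := tailDecay_pos (n := m) hγ hmN
  rw [h0, h1] at h2
  rw [h0]
  unfold optimalTailCost at h2 ⊢
  rw [if_pos (by omega), if_neg (by omega), Nat.sub_self, tailDecay_zero, mul_one] at h2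
  rw [if_pos (by omega), tailDecay_zero, mul_one]
  have hS : ∑ n ∈ Finset.range m, optimalStageCost γ ω N m n =
      (1 - shiftedDecay γ ω N m) / tailDecay γ N m - (1 - shiftedDecay γ ω N m) := by linarith
  rw [hS, performanceGap]
  set Q := shiftedDecay γ ω N m
  set q := tailDecay γ N m
  have hQ' : 1 - Q ≠ 0 := by linarith
  have hq' : 1 - q ≠ 0 := by linarith
  have e : (1 - Q) / q - (1 - Q) = (1 - Q) * (1 - q) / q := by field_simp
  rw [e]
  field_simp
  ring

/-! ### The optimal value -/

section OptValue

variable {β : ℝ → ℝ → ℝ} {c : ℕ → ℝ} {ω : ℝ} {N m : ℕ}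

theorem optValue_le_of_isFeasible {l : ℕ → ℝ} {ν : ℝ} (hf : IsFeasible β ω N m l ν) :
    optValue β ω N m ≤
      (((tailCost ω N l 0 - ν) / ∑ n ∈ Finset.range m, l n : ℝ) : EReal) :=
  sInf_le ⟨l, ν, hf, rfl⟩

theorem le_optValue {a : ℝ} (h : ∀ l ν, IsFeasible β ω N m l ν →
    a ≤ (tailCost ω N l 0 - ν) / ∑ n ∈ Finset.range m, l n) :
    (a : EReal) ≤ optValue β ω N m := by
  refine le_sInf ?_
  rintro _ ⟨l, ν, hf, rfl⟩
  exact EReal.coe_le_coe_iff.2 (h l ν hf)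

theorem optValue_eq_top (h : ∀ l ν, ¬ IsFeasible β ω N m l ν) : optValue β ω N m = ⊤ := by
  refine top_unique (le_sInf ?_)
  rintro _ ⟨l, ν, hf, rfl⟩
  exact absurd hf (h l ν)

theorem one_le_optValue (hβ : ∀ (r : ℝ) (n : ℕ), 0 ≤ r → β r n = c n * r)
    (hm : 1 ≤ m) (hmN : m + 1 ≤ N) (hg : growthBound c ω (m + 1) ≤ ω) :
    1 ≤ optValue β ω N m := by
  have := le_optValue (β := β) (ω := ω) (N := N) (m := m) (a := 1)
    fun l ν hf => hf.one_le_objective hβ hm hmN hg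
  simpa using this

theorem optValue_eq (hβ : ∀ (r : ℝ) (n : ℕ), 0 ≤ r → β r n = c n * r)
    (hc : ∀ n k, c (n + k) ≤ c n * c k) (hω : 1 ≤ ω) (hm : 1 ≤ m) (hmN : m + 1 ≤ N)
    (hγ : ∀ i, 2 ≤ i → i ≤ N → 1 < growthBound c ω i) (hg : ω < growthBound c ω (m + 1)) :
    optValue β ω N m = ((1 - performanceGap (growthBound c ω) ω N m : ℝ) : EReal) := by
  refine le_antisymm ?_ (le_optValue fun l ν hf => hf.one_sub_gap_le_objective hβ hω hm hmN hg)
  rw [← objective_optimalStageCost hγ hω hm hmN]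
  exact optValue_le_of_isFeasible (isFeasible_optimalStageCost hβ hc hω hm hmN hγ hg.le)

/-- Enlarging the first stage cost pushes the objective towards `1`. -/
theorem optValue_le_one (hβ : ∀ (r : ℝ) (n : ℕ), 0 ≤ r → β r n = c n * r)
    (hω : 1 ≤ ω) (hm : 1 ≤ m) (hmN : m + 1 ≤ N)
    (hγ : ∀ i, 2 ≤ i → i ≤ N → 1 < growthBound c ω i) :
    optValue β ω N m ≤ 1 := by
  set γ := growthBound c ω with hγdef
  -- Chosen so that T_k is exactly the contraction over k steps: every tail constraint is tight.
  -- Unlike `optimalStageCost`, this needs no relation between ω and γ_{m+1}.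
  let l : ℕ → ℝ := fun n => if n = N - 1 then tailDecay γ N n / ω else tailDecay γ N n / γ (N - n)
  have hlpos : ∀ n, n < N → 0 < l n := by
    intro n hn
    have hq := tailDecay_pos (n := n) hγ (by omega)
    simp only [l]
    split_ifs with h
    · positivity
    · exact div_pos hq (by linarith [hγ (N - n) (by omega) (by omega)])
  have hT : ∀ k, k + 1 ≤ N → tailCost ω N l k = tailDecay γ N k := by
    intro k hk
    refine tailCost_eq_of_recursion l (tailDecay γ N) ?_ ?_ hk
    · simp only [l, if_true]; field_simp
    · intro k hk
      simp only [l]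
      rw [if_neg (by omega), tailDecay_div]; ring
  -- Taking ν to be the smallest stage cost makes the ν constraints trivial, since the growth bounds
  -- exceed 1.
  obtain ⟨n₀, hn₀, hmin⟩ := Finset.exists_min_image (Finset.range N) l ⟨0, by simpa using by omega⟩
  have hν : 0 < l n₀ := hlpos n₀ (Finset.mem_range.1 hn₀)
  have key : ∀ X : ℝ, 0 < X → optValue β ω N m ≤ ((1 + 1 / X : ℝ) : EReal) := by
    intro X hX
    let l' : ℕ → ℝ := fun n => if n = 0 then l 0 + X else l n
    have hl'0 : l' 0 = l 0 + X := by simp [l']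
    have hl' : ∀ n, 1 ≤ n → l' n = l n := fun n hn => if_neg (by omega)
    have hl'pos : ∀ n, n < N → 0 < l' n := by
      intro n hn
      rcases Nat.eq_zero_or_pos n with rfl | h
      · rw [hl'0]; linarith [hlpos 0 hn]
      · rw [hl' n h]; exact hlpos n hn
    have hT' : ∀ k, 1 ≤ k → tailCost ω N l' k = tailCost ω N l k := by
      intro k hk
      unfold tailCost
      rw [hl' (N - 1) (by omega), Finset.sum_congr rfl fun n hn =>
        hl' n (hk.trans (Finset.mem_Ico.1 hn).1)]
    have hT'0 : tailCost ω N l' 0 = 1 + X := by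
      have h1 := tailCost_eq_add (ω := ω) l' (k := 0) (N := N) (by omega)
      have h2 := tailCost_eq_add (ω := ω) l (k := 0) (N := N) (by omega)
      rw [hT 0 (by omega), tailDecay_zero] at h2
      rw [h1, hT' _ le_rfl, hl'0]
      linarith
    have hlk : ∀ k, k + 2 ≤ N → γ (N - k) * l k = tailDecay γ N k := by
      intro k hk
      have := hγ (N - k) (by omega) (by omega)
      simp only [l]
      rw [if_neg (by omega)]
      field_simp
    have hf : IsFeasible β ω N m l' (l n₀) := by
      refine ⟨hl'pos, hν, fun k hk => ?_, fun j hj => ?_⟩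
      · rw [boundB_eq hβ ω _ (hl'pos k (by omega)).le, ← hγdef]
        rcases Nat.eq_zero_or_pos k with rfl | h
        · have h1 := hlk 0 hk
          rw [tailDecay_zero] at h1
          have := hγ (N - 0) (by omega) (by omega)
          rw [hT'0, hl'0]
          nlinarith
        · rw [hT' k h, hl' k h, hlk k hk, hT k (by omega)]
      · rw [boundB_eq hβ ω _ (hl'pos _ (by omega)).le, ← hγdef, hl' _ (by omega)]
        have h1 : 0 ≤ ∑ n ∈ Finset.range j, l' (n + m) := Finset.sum_nonneg fun n hn =>
          (hl'pos _ (by have := Finset.mem_range.1 hn; omega)).le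
        have h2 := hmin (j + m) (Finset.mem_range.2 (by omega))
        have h3 := hγ (N - j) (by omega) (by omega)
        nlinarith [hlpos (j + m) (by omega)]
    refine (optValue_le_of_isFeasible hf).trans (EReal.coe_le_coe_iff.2 ?_)
    have hS : X ≤ ∑ n ∈ Finset.range m, l' n := by
      have := Finset.single_le_sum (f := l') (s := Finset.range m)
        (fun n hn => (hl'pos n (by have := Finset.mem_range.1 hn; omega)).le)
        (Finset.mem_range.2 (by omega : 0 < m))
      rw [hl'0] at this
      linarith [hlpos 0 (by omega)]
    rw [hT'0, div_le_iff₀ (by linarith)]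
    have h1 : 1 / X * X = 1 := by field_simp
    have h2 := mul_le_mul_of_nonneg_left hS (by positivity : 0 ≤ 1 / X)
    nlinarith
  refine le_of_forall_gt_imp_ge_of_dense fun a ha => ?_
  obtain ⟨r, hr1, hr2⟩ := EReal.lt_iff_exists_real_btwn.1 ha
  have hr : 1 < r := by exact_mod_cast hr1
  refine (key (1 / (r - 1)) (by have : 0 < r - 1 := by linarith
                                positivity)).trans ?_
  rw [one_div_one_div, add_sub_cancel]
  exact hr2.le

end OptValue

/-! ### Comparing control horizons -/

/-- The comparison of the performance gaps, reduced to one inequality. -/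
theorem performanceGap_le {γ : ℕ → ℝ} {ω : ℝ} {m M : ℕ}
    (hγ : ∀ i, 2 ≤ i → i ≤ m + M → 1 < γ i) (hω : 1 ≤ ω) (hm : 1 ≤ m) (hM : 1 ≤ M)
    (hle : (γ (M + 1) - ω) * (1 - tailDecay γ (m + M) m) ≤
      (γ (m + 1) - ω) * (1 - tailDecay γ (m + M) M)) :
    performanceGap γ ω (m + M) M ≤ performanceGap γ ω (m + M) m := by
  have hG := hγ (m + 1) (by omega) (by omega)
  have hH := hγ (M + 1) (by omega) (by omega)
  have hQm := shiftedDecay_lt_one hγ hω hm (by omega)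
  have hQM := shiftedDecay_lt_one hγ hω hM (by omega)
  have hx0 := tailDecay_pos (n := M) hγ (by omega)
  have hy0 := tailDecay_pos (n := m) hγ (by omega)
  have hx1 := tailDecay_lt_one hγ hM (by omega)
  have hy1 := tailDecay_lt_one hγ hm (by omega)
  have em := shiftedDecay_eq (ω := ω) (N := m + M) (m := m) (by omega) hG
  have eM := shiftedDecay_eq (ω := ω) (N := m + M) (m := M) (by omega) hH
  rw [Nat.add_sub_cancel_left] at em
  rw [Nat.add_sub_cancel] at eM
  unfold performanceGap
  rw [em] at hQm ⊢
  rw [eM] at hQM ⊢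
  set G := γ (m + 1)
  set H := γ (M + 1)
  set x := tailDecay γ (m + M) M
  set y := tailDecay γ (m + M) m
  set a := (G - ω) / (G - 1) with ha
  set b := (H - ω) / (H - 1) with hb
  rw [div_le_div_iff₀ (mul_pos (by linarith) (by linarith)) (mul_pos (by linarith) (by linarith))]
  -- After cross-multiplication the common factor xy splits off and this difference remains; 1 - a
  -- and 1 - b both carry the factor ω - 1.
  have h1 : a * (1 - b) * (1 - x) - b * (1 - a) * (1 - y) =
      (ω - 1) / ((G - 1) * (H - 1)) * ((G - ω) * (1 - x) - (H - ω) * (1 - y)) := by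
    have : G - 1 ≠ 0 := by linarith
    have : H - 1 ≠ 0 := by linarith
    rw [ha, hb]
    field_simp
    ring
  have h2 : 0 ≤ (ω - 1) / ((G - 1) * (H - 1)) * ((G - ω) * (1 - x) - (H - ω) * (1 - y)) :=
    mul_nonneg (div_nonneg (by linarith) (mul_nonneg (by linarith) (by linarith)))
      (by linarith)
  rw [← h1] at h2
  have h3 := mul_nonneg (mul_pos hx0 hy0).le h2
  linear_combination h3

theorem comparison_of_growthBound_le {γ : ℕ → ℝ} {ω : ℝ} {m M : ℕ}
    (hγ : ∀ i, 2 ≤ i → i ≤ m + M → 1 < γ i) (hm : 1 ≤ m) (hmM : m ≤ M)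
    (hH : ω < γ (M + 1)) (hGH : γ (M + 1) ≤ γ (m + 1)) :
    (γ (M + 1) - ω) * (1 - tailDecay γ (m + M) m) ≤
      (γ (m + 1) - ω) * (1 - tailDecay γ (m + M) M) := by
  have h1 := tailDecay_anti hγ hmM (by omega)
  have h2 := tailDecay_lt_one (n := m) hγ hm (by omega)
  exact mul_le_mul (by linarith) (by linarith) (by linarith) (by linarith)

/-! ### Exponential decay -/

theorem prod_one_sub_nonneg_le_one {ι : Type*} (s : Finset ι) {u : ι → ℝ}
    (hu0 : ∀ i ∈ s, 0 ≤ u i) (hu1 : ∀ i ∈ s, u i ≤ 1) :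
    0 ≤ ∏ i ∈ s, (1 - u i) ∧ ∏ i ∈ s, (1 - u i) ≤ 1 :=
  ⟨Finset.prod_nonneg fun i hi => by linarith [hu1 i hi],
    Finset.prod_le_one (fun i hi => by linarith [hu1 i hi]) fun i hi => by linarith [hu0 i hi]⟩

/-- Chord inequality on [0,1] for the convex function t ↦ ∏ (1 - t u_i). -/
theorem prod_one_sub_mul_le {ι : Type*} (s : Finset ι) {u : ι → ℝ} {t : ℝ}
    (ht0 : 0 ≤ t) (ht1 : t ≤ 1) (hu0 : ∀ i ∈ s, 0 ≤ u i) (hu1 : ∀ i ∈ s, u i ≤ 1) :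
    ∏ i ∈ s, (1 - t * u i) ≤ 1 - t + t * ∏ i ∈ s, (1 - u i) := by
  classical
  induction s using Finset.induction_on with
  | empty => simp
  | insert a s ha ih =>
    rw [Finset.prod_insert ha, Finset.prod_insert ha]
    have hs0 := fun i hi => hu0 i (Finset.mem_insert_of_mem hi)
    have hs1 := fun i hi => hu1 i (Finset.mem_insert_of_mem hi)
    have h1 := ih hs0 hs1
    have h2 := (prod_one_sub_nonneg_le_one s hs0 hs1).2
    have ha0 := hu0 a (Finset.mem_insert_self _ _)
    have ha1 := hu1 a (Finset.mem_insert_self _ _)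
    have h3 : 0 ≤ 1 - t * u a := by nlinarith
    have h4 := mul_le_mul_of_nonneg_left h1 h3
    have h5 : 0 ≤ t * u a * ((1 - t) * (1 - ∏ i ∈ s, (1 - u i))) :=
      mul_nonneg (mul_nonneg ht0 ha0) (mul_nonneg (by linarith) (by linarith))
    linarith

/-- When no u_i equals 1, this is the chord inequality for the convex function t ↦ 1 / ∏ (1 - t
u_i), cleared of denominators. -/
theorem prod_one_sub_le_mul {ι : Type*} (s : Finset ι) {u : ι → ℝ} {t : ℝ}
    (ht0 : 0 ≤ t) (ht1 : t ≤ 1) (hu0 : ∀ i ∈ s, 0 ≤ u i) (hu1 : ∀ i ∈ s, u i ≤ 1) :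
    ∏ i ∈ s, (1 - u i) ≤
      (∏ i ∈ s, (1 - t * u i)) * (t + (1 - t) * ∏ i ∈ s, (1 - u i)) := by
  classical
  induction s using Finset.induction_on with
  | empty => simp
  | insert a s ha ih =>
    rw [Finset.prod_insert ha, Finset.prod_insert ha]
    have hs0 := fun i hi => hu0 i (Finset.mem_insert_of_mem hi)
    have hs1 := fun i hi => hu1 i (Finset.mem_insert_of_mem hi)
    have h1 := ih hs0 hs1
    have h2 := prod_one_sub_nonneg_le_one s hs0 hs1
    have ha0 := hu0 a (Finset.mem_insert_self _ _)
    have ha1 := hu1 a (Finset.mem_insert_self _ _)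
    have hW : 0 ≤ ∏ i ∈ s, (1 - t * u i) := Finset.prod_nonneg fun i hi => by
      nlinarith [hs0 i hi, hs1 i hi]
    set W := ∏ i ∈ s, (1 - t * u i)
    set w := ∏ i ∈ s, (1 - u i)
    have h4 := mul_le_mul_of_nonneg_left h1 (by linarith : 0 ≤ 1 - u a)
    have h5 : 0 ≤ 1 - (1 - u a) * w := by nlinarith
    have h6 : 0 ≤ W * (t * u a * ((1 - t) * (1 - (1 - u a) * w))) :=
      mul_nonneg hW (mul_nonneg (mul_nonneg ht0 ha0) (mul_nonneg (by linarith) h5))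
    linarith

section Exponential

variable {σ ω : ℝ}

theorem growthBound_pow_rec (k : ℕ) :
    growthBound (fun n => σ ^ n) ω (k + 2) = 1 + σ * growthBound (fun n => σ ^ n) ω (k + 1) := by
  rw [growthBound_succ, growthBound_succ, Finset.sum_range_succ', mul_add, Finset.mul_sum]
  simp only [pow_succ']
  ring

theorem growthBound_pow_eq (hσ : σ < 1) (k : ℕ) :
    growthBound (fun n => σ ^ n) ω (k + 1) = 1 / (1 - σ) + (ω - 1 / (1 - σ)) * σ ^ k := by
  rw [growthBound_succ, geom_sum_eq hσ.ne]
  have : 1 - σ ≠ 0 := by linarith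
  have : σ - 1 ≠ 0 := by linarith
  field_simp
  ring

theorem growthBound_pow_pos (hσ0 : 0 < σ) (hω : 1 ≤ ω) (k : ℕ) :
    0 < growthBound (fun n => σ ^ n) ω k := by
  unfold growthBound
  have : 0 ≤ ∑ n ∈ Finset.range (k - 1), σ ^ n := Finset.sum_nonneg fun n _ => by positivity
  positivity

theorem one_lt_growthBound_pow (hσ0 : 0 < σ) (hω : 1 ≤ ω) {k : ℕ} (hk : 2 ≤ k) :
    1 < growthBound (fun n => σ ^ n) ω k := by
  obtain ⟨j, rfl⟩ := Nat.exists_eq_add_of_le' hk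
  rw [growthBound_pow_rec]
  have := mul_pos hσ0 (growthBound_pow_pos hσ0 hω (j + 1))
  linarith

/-- By the recursion h_{k+1} = 1 + σ h_k, each factor 1 - 1/h_{k+1} is σ h_k / h_{k+1}, and the
product telescopes. -/
theorem tailDecay_pow (hσ0 : 0 < σ) (hω : 1 ≤ ω) {N n : ℕ} (hn : n + 1 ≤ N) :
    tailDecay (growthBound (fun n => σ ^ n) ω) N n =
      σ ^ n * growthBound (fun n => σ ^ n) ω (N - n) / growthBound (fun n => σ ^ n) ω N := by
  induction n with
  | zero =>
    have := growthBound_pow_pos hσ0 hω N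
    rw [tailDecay_zero]; simp [this.ne']
  | succ n ih =>
    rw [tailDecay_succ, ih (by omega)]
    obtain ⟨j, hj⟩ : ∃ j, N - n = j + 2 := ⟨N - n - 2, by omega⟩
    rw [(by omega : N - (n + 1) = j + 1), hj]
    have h1 := growthBound_pow_pos hσ0 hω N
    have h2 := growthBound_pow_pos hσ0 hω (j + 2)
    have h3 := growthBound_pow_rec (σ := σ) (ω := ω) j
    field_simp
    rw [h3]
    ring

theorem growthBound_const_mul (C : ℝ) (c : ℕ → ℝ) (k : ℕ) :
    growthBound (fun n => C * c n) ω k = C * growthBound c ω k := by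
  unfold growthBound
  rw [← Finset.mul_sum]
  ring

/-- For overshoot constant `1` the comparison is an identity. -/
theorem comparison_pow_eq (hσ0 : 0 < σ) (hσ : σ < 1) (hω : 1 ≤ ω) {m M : ℕ}
    (hm : 1 ≤ m) (hM : 1 ≤ M) :
    (growthBound (fun n => σ ^ n) ω (M + 1) - ω) *
        (1 - tailDecay (growthBound (fun n => σ ^ n) ω) (m + M) m) =
      (growthBound (fun n => σ ^ n) ω (m + 1) - ω) *
        (1 - tailDecay (growthBound (fun n => σ ^ n) ω) (m + M) M) := by
  -- Both sides equal (1/(1-σ) - ω)(1-σ^m)(1-σ^M) / ((1-σ) h_{m+M}).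
  rw [tailDecay_pow hσ0 hω (by omega), tailDecay_pow hσ0 hω (by omega),
    Nat.add_sub_cancel_left, Nat.add_sub_cancel]
  have h1 := growthBound_pow_pos hσ0 hω (m + M)
  obtain ⟨a, rfl⟩ := Nat.exists_eq_add_of_le' hm
  obtain ⟨b, rfl⟩ := Nat.exists_eq_add_of_le' hM
  rw [(by ring : a + 1 + (b + 1) = (a + b + 1) + 1)] at h1 ⊢
  have h2 := growthBound_pow_eq (ω := ω) hσ (a + b + 1)
  have e : ∀ p q : ℝ, 1 - p * q / growthBound (fun n => σ ^ n) ω (a + b + 1 + 1) =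
      (growthBound (fun n => σ ^ n) ω (a + b + 1 + 1) - p * q) /
        growthBound (fun n => σ ^ n) ω (a + b + 1 + 1) := fun p q => by field_simp
  rw [e, e, ← mul_div_assoc, ← mul_div_assoc]
  congr 1
  simp only [growthBound_pow_eq hσ]
  ring

theorem comparison_exponential {C : ℝ} (hC : 1 ≤ C) (hσ0 : 0 < σ) (hσ : σ < 1) (hω : 1 ≤ ω)
    {m M : ℕ} (hm : 1 ≤ m) (hmM : m ≤ M)
    (hH : ω < growthBound (fun n => C * σ ^ n) ω (M + 1)) :
    (growthBound (fun n => C * σ ^ n) ω (M + 1) - ω) *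
        (1 - tailDecay (growthBound (fun n => C * σ ^ n) ω) (m + M) m) ≤
      (growthBound (fun n => C * σ ^ n) ω (m + 1) - ω) *
        (1 - tailDecay (growthBound (fun n => C * σ ^ n) ω) (m + M) M) := by
  have hCh : ∀ k, growthBound (fun n => C * σ ^ n) ω k = C * growthBound (fun n => σ ^ n) ω k :=
    growthBound_const_mul C _
  have hγ : ∀ i, 2 ≤ i → i ≤ m + M → 1 < growthBound (fun n => C * σ ^ n) ω i := by
    intro i hi _
    rw [hCh]
    nlinarith [one_lt_growthBound_pow hσ0 hω hi]
  rcases le_or_gt (growthBound (fun n => C * σ ^ n) ω (M + 1))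
    (growthBound (fun n => C * σ ^ n) ω (m + 1)) with hGH | hGH
  · exact comparison_of_growthBound_le hγ hm hmM hH hGH
  have hbase := comparison_pow_eq hσ0 hσ hω hm (hm.trans hmM)
  set h := growthBound (fun n => σ ^ n) ω with hdef
  rw [hCh, hCh] at hGH
  have hlt : h (m + 1) < h (M + 1) := lt_of_mul_lt_mul_left hGH (by linarith)
  -- The sequence h_{k+1} is monotone in k and starts at ω; `hlt` shows that it does not decrease.
  have hωh : ω ≤ h (m + 1) := by
    have e1 := growthBound_pow_eq (ω := ω) hσ m
    have e2 := growthBound_pow_eq (ω := ω) hσ M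
    rw [← hdef] at e1 e2
    rw [e1, e2] at hlt
    have hpow : σ ^ M ≤ σ ^ m := pow_le_pow_of_le_one hσ0.le hσ.le hmM
    have hpow1 : σ ^ m ≤ 1 := pow_le_one₀ hσ0.le hσ.le
    have hg : 0 ≤ 1 / (1 - σ) - ω := by
      by_contra hneg
      nlinarith
    rw [e1]
    nlinarith
  have hu : ∀ k, k < M → 0 ≤ 1 / h (m + M - k) ∧ 1 / h (m + M - k) ≤ 1 := by
    intro k hk
    have h1 := one_lt_growthBound_pow (σ := σ) (ω := ω) hσ0 hω (k := m + M - k) (by omega)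
    have := one_sub_one_div_mem h1
    constructor <;> linarith
  have hC0 : 0 < C := by linarith
  have ht0 : 0 ≤ 1 / C := by positivity
  have ht1 : 1 / C ≤ 1 := by rw [div_le_one hC0]; exact hC
  have hsplit : ∀ γ : ℕ → ℝ, tailDecay γ (m + M) M =
      tailDecay γ (m + M) m * ∏ k ∈ Finset.Ico m M, (1 - 1 / γ (m + M - k)) := fun γ =>
    (Finset.prod_range_mul_prod_Ico _ hmM).symm
  have hfac : ∀ s : Finset ℕ, ∏ k ∈ s, (1 - 1 / growthBound (fun n => C * σ ^ n) ω (m + M - k)) =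
      ∏ k ∈ s, (1 - 1 / C * (1 / h (m + M - k))) := fun s =>
    Finset.prod_congr rfl fun k _ => by rw [hCh, one_div_mul_one_div]
  have hW1 := prod_one_sub_mul_le (Finset.Ico m M) (u := fun k => 1 / h (m + M - k)) ht0 ht1
    (fun k hk => (hu k (Finset.mem_Ico.1 hk).2).1) (fun k hk => (hu k (Finset.mem_Ico.1 hk).2).2)
  have hW2 := prod_one_sub_le_mul (Finset.range m) (u := fun k => 1 / h (m + M - k)) ht0 ht1
    (fun k hk => (hu k ((Finset.mem_range.1 hk).trans_le hmM)).1)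
    (fun k hk => (hu k ((Finset.mem_range.1 hk).trans_le hmM)).2)
  have hw2 : 0 < tailDecay h (m + M) m :=
    tailDecay_pos (fun i hi _ => one_lt_growthBound_pow hσ0 hω hi) (by omega)
  have hW2pos : 0 < tailDecay (growthBound (fun n => C * σ ^ n) ω) (m + M) m :=
    tailDecay_pos hγ (by omega)
  rw [← hfac] at hW1 hW2
  rw [hsplit] at hbase ⊢
  rw [hCh, hCh]
  change tailDecay h (m + M) m ≤ tailDecay (growthBound (fun n => C * σ ^ n) ω) (m + M) m *
    (1 / C + (1 - 1 / C) * tailDecay h (m + M) m) at hW2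
  -- Capitals belong to C, lower case to C = 1. With the longer product split at m, the goal is
  -- C(h_{M+1} - h_{m+1})(1-W2) ≤ (C h_{m+1} - ω)(1-W1)W2. The identity for C = 1 becomes `h4`; the
  -- chord inequalities become `h1` and `h2`, which transfer it to C.
  set W1 := ∏ k ∈ Finset.Ico m M, (1 - 1 / growthBound (fun n => C * σ ^ n) ω (m + M - k))
  set w1 := ∏ k ∈ Finset.Ico m M, (1 - 1 / h (m + M - k))
  set W2 := tailDecay (growthBound (fun n => C * σ ^ n) ω) (m + M) m
  set w2 := tailDecay h (m + M) m
  have hw1 : w1 ≤ 1 := (prod_one_sub_nonneg_le_one _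
    (fun k hk => (hu k (Finset.mem_Ico.1 hk).2).1)
    (fun k hk => (hu k (Finset.mem_Ico.1 hk).2).2)).2
  have hCt : C * (1 / C) = 1 := by field_simp
  set t := 1 / C
  have h1 : C * (1 - W2) * w2 ≤ (1 - w2) * W2 := by
    have := mul_le_mul_of_nonneg_left hW2 hC0.le
    have e : C * (W2 * (t + (1 - t) * w2)) = W2 * (C * t) + W2 * w2 * C - W2 * w2 * (C * t) := by
      ring
    rw [e, hCt] at this
    linarith
  have h2 : 1 - w1 ≤ C * (1 - W1) := by
    have := mul_le_mul_of_nonneg_left hW1 hC0.le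
    have e : C * (1 - t + t * w1) = C - C * t + C * t * w1 := by ring
    rw [e, hCt] at this
    linarith
  have h2' : 0 ≤ 1 - W1 := by
    by_contra hneg
    nlinarith
  have h3 : (h (m + 1) - ω) * (1 - w1) ≤ (C * h (m + 1) - ω) * (1 - W1) := by
    have a1 := mul_le_mul_of_nonneg_left h2 (sub_nonneg.2 hωh)
    have a2 : C * (h (m + 1) - ω) ≤ C * h (m + 1) - ω := by nlinarith
    have a3 := mul_le_mul_of_nonneg_right a2 h2'
    linarith
  have h4 : (h (M + 1) - h (m + 1)) * (1 - w2) = (h (m + 1) - ω) * (1 - w1) * w2 := by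
    linear_combination hbase
  have h5 : (C * h (M + 1) - C * h (m + 1)) * (1 - W2) * w2 ≤
      (C * h (m + 1) - ω) * (1 - W1) * W2 * w2 := by
    calc (C * h (M + 1) - C * h (m + 1)) * (1 - W2) * w2
        = (h (M + 1) - h (m + 1)) * (C * (1 - W2) * w2) := by ring
      _ ≤ (h (M + 1) - h (m + 1)) * ((1 - w2) * W2) :=
        mul_le_mul_of_nonneg_left h1 (by linarith)
      _ = (h (m + 1) - ω) * (1 - w1) * (W2 * w2) := by linear_combination W2 * h4
      _ ≤ (C * h (m + 1) - ω) * (1 - W1) * (W2 * w2) :=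
        mul_le_mul_of_nonneg_right h3 (mul_pos hW2pos hw2).le
      _ = _ := by ring
  have h6 := le_of_mul_le_mul_right h5 hw2
  linarith

end Exponential

/-! ### Finite time decay -/

theorem comparison_finite {c : ℕ → ℝ} {ω : ℝ} (hc0 : ∀ n, 0 ≤ c n)
    (hc : ∀ n k, c (n + k) ≤ c n * c k) (hc3 : ∀ n, 3 ≤ n → c n = 0) (hω : 1 ≤ ω)
    {m M : ℕ} (hm : 1 ≤ m) (hmM : m < M)
    (hγ : ∀ i, 2 ≤ i → i ≤ m + M → 1 < growthBound c ω i)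
    (hH : ω < growthBound c ω (M + 1)) :
    (growthBound c ω (M + 1) - ω) * (1 - tailDecay (growthBound c ω) (m + M) m) ≤
      (growthBound c ω (m + 1) - ω) * (1 - tailDecay (growthBound c ω) (m + M) M) := by
  have hbig : ∀ j, growthBound c ω (j + 4) = c 0 + c 1 + c 2 := by
    intro j
    rw [growthBound_succ, hc3 (j + 3) (by omega), add_comm j 3, Finset.sum_range_add,
      Finset.sum_eq_zero (fun i _ => hc3 (3 + i) (by omega))]
    simp [Finset.sum_range_succ]
  have hγ3 : growthBound c ω 3 = c 0 + c 1 + ω * c 2 := by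
    simp [growthBound, Finset.sum_range_succ]
  have hγ2 : growthBound c ω 2 = c 0 + ω * c 1 := by simp [growthBound]
  have hle3 : ∀ k, 3 ≤ k → growthBound c ω k ≤ growthBound c ω 3 := by
    intro k hk
    rcases hk.eq_or_lt with rfl | hk
    · exact le_rfl
    · obtain ⟨j, rfl⟩ := Nat.exists_eq_add_of_le' (show 4 ≤ k from hk)
      rw [hbig, hγ3]
      nlinarith [hc0 2]
  rcases Nat.lt_or_ge m 3 with hm3 | hm3
  swap
  · refine comparison_of_growthBound_le hγ hm hmM.le hH (le_of_eq ?_)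
    rw [(by omega : M + 1 = (M - 3) + 4), (by omega : m + 1 = (m - 3) + 4), hbig, hbig]
  rcases (by omega : m = 2 ∨ m = 1) with rfl | rfl
  · exact comparison_of_growthBound_le hγ hm hmM.le hH (hle3 _ (by omega))
  have h2 := hγ 2 le_rfl (by omega)
  have hH1 := hγ (M + 1) (by omega) (by omega)
  have hHle := hle3 (M + 1) (by omega)
  have h0 : 1 ≤ c 0 := by
    rcases (hc0 0).eq_or_lt with h | h
    · have h1 := hc 0 1
      rw [← h, zero_mul] at h1
      have := hc0 1
      rw [hγ2, ← h] at h2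
      nlinarith
    · have := hc 0 0
      by_contra hlt
      simp only [add_zero] at this
      nlinarith
  have hc2 : c 2 ≤ c 1 * c 1 := hc 1 1
  have hc1 := hc0 1
  -- Otherwise c_0 < ω(1 - c_1); multiplying by 1 + c_1 and using c_2 ≤ c_1² and c_0 ≥ 1 gives γ_3 <
  -- ω, against `hb`.
  have hgω : ω ≤ growthBound c ω 2 := by
    by_contra hlt
    have hb : ω < growthBound c ω 3 := hH.trans_le hHle
    rw [hγ2] at hlt
    rw [hγ3] at hb
    have a1 : c 0 < ω * (1 - c 1) := by linarith
    have a2 := mul_lt_mul_of_pos_right a1 (by linarith : 0 < 1 + c 1)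
    have a3 := mul_le_mul_of_nonneg_left hc2 (by linarith : 0 ≤ ω)
    nlinarith
  -- The right side exceeds the left by at least (c_0 - 1)(γ_2 - ω + ωc_1).
  have hmain : ω * (growthBound c ω (M + 1) - growthBound c ω 2) ≤
      (growthBound c ω 2 - ω) * (growthBound c ω 2 - 1) := by
    have a1 := mul_le_mul_of_nonneg_left hHle (by linarith : 0 ≤ ω)
    have a2 := mul_nonneg (sub_nonneg.2 h0) (by nlinarith : 0 ≤ growthBound c ω 2 - ω + ω * c 1)
    have a3 := mul_le_mul_of_nonneg_left hc2 (by positivity : 0 ≤ ω * ω)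
    rw [hγ3, hγ2] at *
    nlinarith
  have hd1 : tailDecay (growthBound c ω) (1 + M) 1 = 1 - 1 / growthBound c ω (M + 1) := by
    rw [tailDecay_succ, tailDecay_zero, one_mul, Nat.sub_zero, add_comm]
  -- Only the first and last factors are kept; they are distinct because M ≥ 2.
  have hdM : tailDecay (growthBound c ω) (1 + M) M ≤
      (1 - 1 / growthBound c ω (M + 1)) * (1 - 1 / growthBound c ω 2) := by
    obtain ⟨b, rfl⟩ := Nat.exists_eq_add_of_le' (show 1 ≤ M by omega)
    rw [tailDecay_succ, (by omega : 1 + (b + 1) - b = 2), ← hd1]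
    exact mul_le_mul_of_nonneg_right (tailDecay_anti hγ (by omega) (by omega))
      (one_sub_one_div_mem h2).1.le
  rw [hd1]
  set H := growthBound c ω (M + 1)
  change _ ≤ (growthBound c ω 2 - ω) * _
  set G := growthBound c ω 2
  have hG0 : 0 < G := by linarith
  have hH0 : 0 < H := by linarith
  have h5 := mul_le_mul_of_nonneg_left (sub_le_sub_left hdM 1) (sub_nonneg.2 hgω)
  refine le_trans ?_ h5
  have e : (G - ω) * (1 - (1 - 1 / H) * (1 - 1 / G)) - (H - ω) * (1 - (1 - 1 / H)) =
      ((G - ω) * (G - 1) - ω * (H - G)) / (G * H) := by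
    field_simp
    ring
  have : 0 ≤ ((G - ω) * (G - 1) - ω * (H - G)) / (G * H) :=
    div_nonneg (by linarith) (by positivity)
  linarith

/-- The comparison of the optimal values for linear submultiplicative bounds. -/
theorem optValue_comparison {β : ℝ → ℝ → ℝ} {c : ℕ → ℝ} {ω : ℝ} {m M : ℕ}
    (hβ : ∀ (r : ℝ) (n : ℕ), 0 ≤ r → β r n = c n * r) (hc : ∀ n k, c (n + k) ≤ c n * c k)
    (hω : 1 ≤ ω) (hm : 1 ≤ m) (hM : 1 ≤ M)
    (hcomp : (∀ i, 2 ≤ i → i ≤ m + M → 1 < growthBound c ω i) → ω < growthBound c ω (M + 1) →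
      (growthBound c ω (M + 1) - ω) * (1 - tailDecay (growthBound c ω) (m + M) m) ≤
      (growthBound c ω (m + 1) - ω) * (1 - tailDecay (growthBound c ω) (m + M) M)) :
    optValue β ω (m + M) m ≤ optValue β ω (m + M) M ∧
      (ω = 1 → optValue β ω (m + M) m = optValue β ω (m + M) M) := by
  by_cases hγ : ∀ i, 2 ≤ i → i ≤ m + M → 1 < growthBound c ω i
  swap
  · have htop : ∀ k, optValue β ω (m + M) k = ⊤ := fun k => optValue_eq_top fun l ν hf =>
      hγ fun i hi hiN => hf.one_lt_growthBound hβ hω hi hiN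
    simp [htop]
  constructor
  · rcases le_or_gt (growthBound c ω (M + 1)) ω with hH | hH
    · exact (optValue_le_one hβ hω hm (by omega) hγ).trans
        (one_le_optValue hβ hM (by omega) hH)
    · have h := hcomp hγ hH
      have hx := tailDecay_lt_one hγ hm (by omega)
      have hy := tailDecay_lt_one hγ hM (by omega)
      -- The left side of the comparison is positive, so the right side is too.
      have hG : ω < growthBound c ω (m + 1) := by
        have h1 := (mul_pos (sub_pos.2 hH) (sub_pos.2 hx)).trans_le h
        exact sub_pos.1 (pos_of_mul_pos_left h1 (sub_pos.2 hy).le)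
      rw [optValue_eq hβ hc hω hm (by omega) hγ hG, optValue_eq hβ hc hω hM (by omega) hγ hH]
      exact EReal.coe_le_coe_iff.2 (sub_le_sub_left (performanceGap_le hγ hω hm hM h) 1)
  · rintro rfl
    have hG := hγ (m + 1) (by omega) (by omega)
    have hH := hγ (M + 1) (by omega) (by omega)
    rw [optValue_eq hβ hc hω hm (by omega) hγ hG, optValue_eq hβ hc hω hM (by omega) hγ hH]
    have e1 := shiftedDecay_eq (ω := 1) (N := m + M) (m := m) (by omega) hG
    have e2 := shiftedDecay_eq (ω := 1) (N := m + M) (m := M) (by omega) hH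
    rw [Nat.add_sub_cancel_left, div_self (by linarith), one_mul] at e1
    rw [Nat.add_sub_cancel, div_self (by linarith), one_mul] at e2
    rw [performanceGap, performanceGap, e1, e2]
    congr 3 <;> ring

theorem proposition7p1 (β : ℝ → ℝ → ℝ) (hβ : IsClassKL0 β)
    (htype : IsExponentialType β ∨
      (IsSubmultiplicative β ∧
        ∃ c : ℕ → ℝ, IsFiniteTimeType β c ∧ ∀ n : ℕ, 3 ≤ n → c n = 0))
    (ω : ℝ) (hω : 1 ≤ ω) (N m : ℕ) (hm : 1 ≤ m) (hmN : m ≤ N / 2) :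
    optValue β ω N m ≤ optValue β ω N (N - m) ∧
      (ω = 1 → optValue β ω N m = optValue β ω N (N - m)) := by
  obtain ⟨M, rfl⟩ : ∃ M, N = m + M := ⟨N - m, by omega⟩
  rw [Nat.add_sub_cancel_left]
  have hmM : m ≤ M := by omega
  rcases hmM.eq_or_lt with rfl | hlt
  · exact ⟨le_rfl, fun _ => rfl⟩
  rcases htype with ⟨C, σ, hC, hσ0, hσ1, h⟩ | ⟨hsub, c, ⟨hc0, -, h⟩, hc3⟩
  · refine optValue_comparison (c := fun n => C * σ ^ n) h (fun n k => ?_) hω hm (by omega)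
      fun _ hH => comparison_exponential hC hσ0 hσ1 hω hm hmM hH
    have : 0 ≤ σ ^ (n + k) := by positivity
    calc C * σ ^ (n + k) ≤ C * (C * σ ^ (n + k)) :=
          mul_le_mul_of_nonneg_left (le_mul_of_one_le_left this hC) (by linarith)
      _ = C * σ ^ n * (C * σ ^ k) := by rw [pow_add]; ring
  · have hc : ∀ n k, c (n + k) ≤ c n * c k := by
      intro n k
      have h1 := hsub 1 n k zero_le_one
      rw [h 1 _ zero_le_one, h 1 n zero_le_one, h _ k (by simpa using hc0 n)] at h1
      linarith
    exact optValue_comparison h hc hω hm (by omega)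
      fun hγ hH => comparison_finite hc0 hc hc3 hω hm hlt hγ hH
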